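/- Let $1<\alpha<2$ and $0<d<1-\frac1\alpha$. Let $\{L_\alpha(t)\}_{t\in\mathbb R}$ be a symmetric $\alpha$-stable motion with Lebesgue control measure, i.e. $L_\alpha(0)=0$ a.s., $L_\alpha$ has independent increments, and $\mathbb E\,e^{i\theta(L_\alpha(t)-L_\alpha(s))}=e^{-(t-s)|\theta|^\alpha}$ for all $s\le t$ and $\theta\in\mathbb R$. For $f\in L^\alpha(\mathbb R)$, the stable integral $\int_{\mathbb R} f\,dL_\alpha$ is the random variable (unique up to a.s. equality) to which the elementary integrals $\sum_i a_i\,(L_\alpha(t_{i+1})-L_\alpha(t_i))$ of the step functions $\varphi_k=\sum_i a_i\mathbf 1_{(t_i,t_{i+1}]}$ converge in probability, for every sequence $(\varphi_k)$ of step functions converging to $f$ in $L^\alpha(\mathbb R)$. Let $g:\mathbb R\to\mathbb R$ be a measurable function such that (C1) $g(t)=0$ for all $t<0$; (C2) there are constants $C>0$ and $c>0$ with $|g(t)|\le Ce^{-ct}$ for all $t\in\mathbb R$. Then the left-sided Riemann–Liouville fractional integral $$(I_+^d g)(x)=\frac1{\Gamma(d)}\int_{-\infty}^x g(t)(x-t)^{d-1}\,dt$$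 converges absolutely for every $x\in\mathbb R$, and $I_+^d g\in L^\alpha(\mathbb R)$. The FIMA stable process $$Y_d(t)=\int_{-\infty}^t (I_+^d g)(t-x)\,dL_\alpha(x)=\int_{\mathbb R}\mathbf 1_{(-\infty,t]}(x)\,(I_+^d g)(t-x)\,dL_\alpha(x),\qquad t\in\mathbb R,$$ is well defined, that is, these stable integrals exist and determine $Y_d(t)$ up to a.s. equality for each $t$. Moreover, $\{Y_d(t)\}_{t\in\mathbb R}$ is stationary: for all $n$, all $t_1,\dots,t_n\in\mathbb R$ and all $h\in\mathbb R$, the random vectors $(Y_d(t_1+h),\dots,Y_d(t_n+h))$ and $(Y_d(t_1),\dots,Y_d(t_n))$ have the same distribution. -/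

import Mathlib

open MeasureTheory ProbabilityTheory Filter Topology

noncomputable section

namespace FIMA

/-- The left-sided Riemann-Liouville fractional integral of order `d`:
`(I_+^d g)(x) = Γ(d)⁻¹ ∫_{-∞}^x g(t) (x - t)^(d-1) dt`. -/
def fracIntegralLeft (d : ℝ) (g : ℝ → ℝ) (x : ℝ) : ℝ :=
  (1 / Real.Gamma d) * ∫ t in Set.Iic x, g t * (x - t) ^ (d - 1)

/-- A symmetric `α`-stable (Lévy) motion indexed by the real line with Lebesgue control measure:
it starts at `0`, has independent increments, and for `s ≤ t` the increment `L t - L s` has law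
`S_α((t - s)^(1/α), 0, 0)`, that is, characteristic function `θ ↦ exp(-(t - s)|θ|^α)`. -/
structure IsStableMotion {Ω : Type*} [MeasurableSpace Ω] (α : ℝ) (L : ℝ → Ω → ℝ)
    (P : Measure Ω) : Prop where
  measurable : ∀ t, Measurable (L t)
  zero : ∀ᵐ ω ∂P, L 0 ω = 0
  indep : HasIndepIncrements L P
  charFun_increment : ∀ s t : ℝ, s ≤ t → ∀ θ : ℝ,
    charFun (P.map (fun ω => L t ω - L s ω)) θ = (Real.exp (-((t - s) * |θ| ^ α)) : ℂ)

/-- A step function `∑ᵢ aᵢ 1_{(tᵢ, tᵢ₊₁]}` with finitely many knots `t₀ < t₁ < ⋯ < tₙ`. -/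
structure StepFunction where
  n : ℕ
  knot : Fin (n + 1) → ℝ
  strictMono_knot : StrictMono knot
  coeff : Fin n → ℝ

/-- The function on the real line given by the step data. -/
def StepFunction.eval (φ : StepFunction) (x : ℝ) : ℝ :=
  ∑ i : Fin φ.n,
    (Set.Ioc (φ.knot i.castSucc) (φ.knot i.succ)).indicator (fun _ => φ.coeff i) x

/-- The elementary stochastic integral `∑ᵢ aᵢ (L(tᵢ₊₁) - L(tᵢ))` of a step function. -/
def StepFunction.stochIntegral {Ω : Type*} (φ : StepFunction) (L : ℝ → Ω → ℝ) (ω : Ω) : ℝ :=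
  ∑ i : Fin φ.n, φ.coeff i * (L (φ.knot i.succ) ω - L (φ.knot i.castSucc) ω)

/-- `Z` is (a version of) the stable stochastic integral `∫ f(x) dL(x)`: `f` lies in `L^α`, and
for every sequence of step functions converging to `f` in `L^α` the elementary integrals converge
to `Z` in probability. -/
structure IsStableIntegral {Ω : Type*} [MeasurableSpace Ω] (α : ℝ) (L : ℝ → Ω → ℝ)
    (P : Measure Ω) (f : ℝ → ℝ) (Z : Ω → ℝ) : Prop where
  memLp : MemLp f (ENNReal.ofReal α) volume
  measurable : Measurable Z
  tendsto : ∀ φ : ℕ → StepFunction,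
    Tendsto (fun k => eLpNorm (fun x => (φ k).eval x - f x) (ENNReal.ofReal α) volume)
      atTop (𝓝 0) →
    TendstoInMeasure P (fun k => (φ k).stochIntegral L) atTop Z

/-- `Y` is (a version of) the fractionally integrated moving average process
`Y t = ∫_{-∞}^t (I_+^d g)(t - x) dL(x)`. -/
def IsFIMAProcess {Ω : Type*} [MeasurableSpace Ω] (α d : ℝ) (g : ℝ → ℝ) (L : ℝ → Ω → ℝ)
    (P : Measure Ω) (Y : ℝ → Ω → ℝ) : Prop :=
  ∀ t : ℝ, IsStableIntegral α L P
    ((Set.Iic t).indicator (fun x => fracIntegralLeft d g (t - x))) (Y t)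

/-- (Strict) stationarity: all finite-dimensional distributions are invariant under time shifts. -/
def IsStationary {Ω : Type*} [MeasurableSpace Ω] (Y : ℝ → Ω → ℝ) (P : Measure Ω) : Prop :=
  ∀ (n : ℕ) (t : Fin n → ℝ) (h : ℝ),
    IdentDistrib (fun ω i => Y (t i + h) ω) (fun ω i => Y (t i) ω) P P

end FIMA

end

/-! Independence of increments gives the elementary integral of a step function `φ` the
characteristic function `exp(-(‖φ‖_α |θ|)^α)`. This has two consequences. Step functions close in
`L^α` have integrals close in probability (`measureReal_stochIntegral_gt_le`), so density of step
functions (`exists_stepFunction_eLpNorm_sub_le`) yields a stable integral, unique a.s., for every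
integrand in `L^α`. By the Cramér–Wold device, the joint law of several stable integrals is a
function of the integrands alone (`identDistrib_of_isStableIntegral`).

Stationarity follows because the kernel depends only on `t - x`: `Y (t + h)` is the integral of the
kernel at time `t` against `L(· + h) - L h`, which is again a stable motion.

The analytic input is `exists_abs_fracIntegralLeft_le`: the fractional integral is `O((1 + |x|)^(d -
1))`, and `d < 1 - 1/α` says exactly that `(1 - d)α > 1`, so this bound lies in `L^α`. -/

noncomputable section

namespace FIMA

/-! ### Linear algebra of step functions -/

/-- The distributional derivative of a step function, up to sign, as a finitely supported
function: `∑ᵢ aᵢ (δ_{tᵢ₊₁} - δ_{tᵢ})`. -/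
def StepFunction.jumps (φ : StepFunction) : ℝ →₀ ℝ :=
  ∑ i : Fin φ.n, φ.coeff i •
    (Finsupp.single (φ.knot i.succ) 1 - Finsupp.single (φ.knot i.castSucc) 1)

/-- Both the values (`v t = 1_{x ≤ t}`) and the elementary integral (`v t = L t ω`) have this form,
so both depend linearly on `jumps` alone. Sums of step functions with different knots then need no
common refinement. -/
lemma StepFunction.linearCombination_jumps (φ : StepFunction) (v : ℝ → ℝ) :
    Finsupp.linearCombination ℝ v φ.jumps =
      ∑ i : Fin φ.n, φ.coeff i * (v (φ.knot i.succ) - v (φ.knot i.castSucc)) := by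
  simp [jumps, map_sum, Finsupp.linearCombination_single]

lemma StepFunction.stochIntegral_eq_linearCombination {Ω : Type*} (φ : StepFunction)
    (L : ℝ → Ω → ℝ) (ω : Ω) :
    φ.stochIntegral L ω = Finsupp.linearCombination ℝ (fun t => L t ω) φ.jumps := by
  rw [linearCombination_jumps]; rfl

lemma StepFunction.eval_eq_linearCombination (φ : StepFunction) (x : ℝ) :
    φ.eval x = Finsupp.linearCombination ℝ (fun t => if x ≤ t then (1 : ℝ) else 0) φ.jumps := by
  rw [linearCombination_jumps]
  refine Finset.sum_congr rfl fun i _ => ?_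
  have h : φ.knot i.castSucc < φ.knot i.succ := φ.strictMono_knot Fin.castSucc_lt_succ
  simp only [Set.indicator_apply, Set.mem_Ioc]
  split_ifs <;> first | (simp; done) | grind

lemma StepFunction.linearCombination_one_jumps (φ : StepFunction) :
    Finsupp.linearCombination ℝ (fun _ => (1 : ℝ)) φ.jumps = 0 := by
  rw [linearCombination_jumps]; simp

/-- Summation by parts. -/
lemma exists_sum_smul_eq_sum_smul_sub {M : Type*} [AddCommGroup M] [Module ℝ M] (n : ℕ)
    (v : Fin (n + 1) → M) (b : Fin (n + 1) → ℝ) (hb : ∑ i, b i = 0) :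
    ∃ a : Fin n → ℝ, ∑ i, b i • v i = ∑ i : Fin n, a i • (v i.succ - v i.castSucc) := by
  induction n with
  | zero =>
    refine ⟨fun _ => 0, ?_⟩
    have : b 0 = 0 := by simpa using hb
    simp [this]
  | succ n ih =>
    -- The weight of the last point is moved to its predecessor, which keeps the total zero; the
    -- error is a multiple of the last increment.
    obtain ⟨a, ha⟩ := ih (fun i => v i.castSucc)
      (fun i => b i.castSucc + if i = Fin.last n then b (Fin.last (n + 1)) else 0) (by
        rw [Fin.sum_univ_castSucc] at hb
        simpa [Finset.sum_add_distrib] using hb)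
    refine ⟨Fin.snoc a (b (Fin.last (n + 1))), ?_⟩
    simp only [add_smul, Finset.sum_add_distrib, ite_smul, zero_smul, Finset.sum_ite_eq',
      Finset.mem_univ, if_true] at ha
    rw [← eq_sub_iff_add_eq] at ha
    rw [Fin.sum_univ_castSucc, ha, Fin.sum_univ_castSucc (n := n)]
    simp only [Fin.snoc_castSucc, Fin.snoc_last, Fin.succ_last, smul_sub, Fin.succ_castSucc]
    abel

/-- The support in increasing order serves as the knots; total mass zero is what summation by parts
needs to produce the coefficients. -/
lemma exists_jumps_eq (c : ℝ →₀ ℝ)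
    (hc : Finsupp.linearCombination ℝ (fun _ => (1 : ℝ)) c = 0) :
    ∃ χ : StepFunction, χ.jumps = c := by
  rcases Nat.eq_zero_or_pos c.support.card with h0 | hpos
  · refine ⟨⟨0, fun _ => 0, fun i j h => absurd h (by omega), fun _ => 0⟩, ?_⟩
    simp only [Finset.card_eq_zero, Finsupp.support_eq_empty] at h0
    simp [StepFunction.jumps, h0]
  · obtain ⟨m, hm⟩ : ∃ m, c.support.card = m + 1 := ⟨c.support.card - 1, by omega⟩
    set e := c.support.orderEmbOfFin hm
    have key : ∀ {M : Type} [AddCommMonoid M] (f : ℝ → M),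
        ∑ i, f (e i) = ∑ t ∈ c.support, f t := by
      intro M _ f
      rw [← Finset.map_orderEmbOfFin_univ c.support hm, Finset.sum_map]
      rfl
    obtain ⟨a, ha⟩ := exists_sum_smul_eq_sum_smul_sub m
      (fun i => Finsupp.single (e i) (1 : ℝ)) (fun i => c (e i)) (by
        rw [key (fun t => c t)]
        simpa [Finsupp.linearCombination_apply, Finsupp.sum] using hc)
    refine ⟨⟨m, e, e.strictMono, a⟩, ?_⟩
    rw [StepFunction.jumps, ← ha, key (fun t => c t • Finsupp.single t (1 : ℝ))]
    conv_rhs => rw [← Finsupp.sum_single c]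
    simp [Finsupp.sum]

/-- Linear combinations of step functions are step functions. -/
lemma exists_stepFunction_sum (Ω : Type*) {ι : Type*} [Fintype ι] (a : ι → ℝ)
    (φ : ι → StepFunction) :
    ∃ χ : StepFunction, (∀ x, χ.eval x = ∑ i, a i * (φ i).eval x) ∧
      ∀ (L : ℝ → Ω → ℝ) ω, χ.stochIntegral L ω = ∑ i, a i * (φ i).stochIntegral L ω := by
  obtain ⟨χ, hχ⟩ := exists_jumps_eq (∑ i, a i • (φ i).jumps) (by
    simp [map_sum, StepFunction.linearCombination_one_jumps])
  refine ⟨χ, fun x => ?_, fun L ω => ?_⟩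
  · simp [StepFunction.eval_eq_linearCombination, hχ, map_sum]
  · simp [StepFunction.stochIntegral_eq_linearCombination, hχ, map_sum]

lemma exists_stepFunction_sub (Ω : Type*) (φ ψ : StepFunction) :
    ∃ χ : StepFunction, (∀ x, χ.eval x = φ.eval x - ψ.eval x) ∧
      ∀ (L : ℝ → Ω → ℝ) ω, χ.stochIntegral L ω = φ.stochIntegral L ω - ψ.stochIntegral L ω := by
  obtain ⟨χ, h1, h2⟩ := exists_stepFunction_sum Ω ![1, -1] ![φ, ψ]
  exact ⟨χ, fun x => by simp [h1, sub_eq_add_neg], fun L ω => by simp [h2, sub_eq_add_neg]⟩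

/-! ### Pointwise values and `L^α` norm of step functions -/

lemma StepFunction.eval_eq_coeff (φ : StepFunction) {x : ℝ} {i : Fin φ.n}
    (hx : x ∈ Set.Ioc (φ.knot i.castSucc) (φ.knot i.succ)) : φ.eval x = φ.coeff i := by
  rw [eval, Finset.sum_eq_single i, Set.indicator_of_mem hx]
  · intro j _ hji
    refine Set.indicator_of_notMem (fun hj => ?_) _
    rcases lt_or_gt_of_ne hji with h | h
    · have : φ.knot j.succ ≤ φ.knot i.castSucc :=
        φ.strictMono_knot.monotone (Fin.succ_le_castSucc_iff.2 h)
      exact absurd (hj.2.trans this) (not_le.2 hx.1)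
    · have : φ.knot i.succ ≤ φ.knot j.castSucc :=
        φ.strictMono_knot.monotone (Fin.succ_le_castSucc_iff.2 h)
      exact absurd (hx.2.trans this) (not_le.2 hj.1)
  · simp

lemma StepFunction.eval_eq_zero (φ : StepFunction) {x : ℝ}
    (hx : ∀ i : Fin φ.n, x ∉ Set.Ioc (φ.knot i.castSucc) (φ.knot i.succ)) : φ.eval x = 0 :=
  Finset.sum_eq_zero fun i _ => Set.indicator_of_notMem (hx i) _

lemma StepFunction.measurable_eval (φ : StepFunction) : Measurable φ.eval := by
  unfold StepFunction.eval
  exact Finset.measurable_sum _ fun i _ => measurable_const.indicator measurableSet_Ioc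

lemma StepFunction.measurable_stochIntegral {Ω : Type*} [MeasurableSpace Ω] (φ : StepFunction)
    {L : ℝ → Ω → ℝ} (hL : ∀ t, Measurable (L t)) : Measurable (φ.stochIntegral L) := by
  unfold StepFunction.stochIntegral
  exact Finset.measurable_sum _ fun i _ => ((hL _).sub (hL _)).const_mul _

/-- The intervals are disjoint, so at most one summand is nonzero at `x` and the power passes inside
the sum. -/
lemma StepFunction.enorm_eval_rpow (φ : StepFunction) {α : ℝ} (hα : 0 < α) (x : ℝ) :
    ‖φ.eval x‖ₑ ^ α = ∑ i : Fin φ.n,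
      (Set.Ioc (φ.knot i.castSucc) (φ.knot i.succ)).indicator
        (fun _ => ENNReal.ofReal (|φ.coeff i| ^ α)) x := by
  by_cases h : ∃ i : Fin φ.n, x ∈ Set.Ioc (φ.knot i.castSucc) (φ.knot i.succ)
  · obtain ⟨i, hi⟩ := h
    let ψ : StepFunction := ⟨φ.n, φ.knot, φ.strictMono_knot, fun i => |φ.coeff i| ^ α⟩
    have h1 := ψ.eval_eq_coeff hi
    rw [φ.eval_eq_coeff hi, Real.enorm_eq_ofReal_abs, ENNReal.ofReal_rpow_of_nonneg (abs_nonneg _)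
      hα.le]
    change _ = |φ.coeff i| ^ α at h1
    rw [← h1, StepFunction.eval, ENNReal.ofReal_sum_of_nonneg]
    · refine Finset.sum_congr rfl fun j _ => ?_
      by_cases hj : x ∈ Set.Ioc (φ.knot j.castSucc) (φ.knot j.succ)
      · simp [ψ, hj, Set.indicator_of_mem]
      · simp [ψ, hj, Set.indicator_of_notMem]
    · exact fun j _ => Set.indicator_nonneg (fun _ _ => Real.rpow_nonneg (abs_nonneg _) _) _
  · push Not at h
    rw [φ.eval_eq_zero h, Finset.sum_eq_zero fun i _ => Set.indicator_of_notMem (h i) _]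
    simp [hα]

lemma StepFunction.eLpNorm_eval (φ : StepFunction) {α : ℝ} (hα : 0 < α) :
    (eLpNorm φ.eval (ENNReal.ofReal α) volume).toReal ^ α =
      ∑ i : Fin φ.n, |φ.coeff i| ^ α * (φ.knot i.succ - φ.knot i.castSucc) := by
  rw [eLpNorm_eq_lintegral_rpow_enorm_toReal (by simpa using hα) (by simp),
    ENNReal.toReal_ofReal hα.le, ENNReal.toReal_rpow, ← ENNReal.rpow_mul,
    one_div_mul_cancel hα.ne', ENNReal.rpow_one]
  simp_rw [φ.enorm_eval_rpow hα]
  rw [lintegral_finsetSum _ fun i _ => measurable_const.indicator measurableSet_Ioc]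
  simp_rw [lintegral_indicator measurableSet_Ioc, lintegral_const, Measure.restrict_apply_univ,
    Real.volume_Ioc]
  rw [ENNReal.toReal_sum fun i _ => by finiteness]
  refine Finset.sum_congr rfl fun i _ => ?_
  have h : φ.knot i.castSucc < φ.knot i.succ := φ.strictMono_knot Fin.castSucc_lt_succ
  rw [ENNReal.toReal_mul, ENNReal.toReal_ofReal (by positivity), ENNReal.toReal_ofReal (by linarith)]

/-! ### Law of elementary integrals and convergence in measure -/

section

variable {Ω : Type*} [MeasurableSpace Ω] {P : Measure Ω}
  {α : ℝ} {L : ℝ → Ω → ℝ}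

/-- The elementary integral of a step function `φ` is symmetric `α`-stable with scale `‖φ‖_α`. -/
lemma IsStableMotion.charFun_stochIntegral (hL : IsStableMotion α L P) (hα : 0 < α)
    (φ : StepFunction) (θ : ℝ) :
    charFun (P.map (φ.stochIntegral L)) θ =
      (Real.exp (-((eLpNorm φ.eval (ENNReal.ofReal α) volume).toReal * |θ|) ^ α) : ℂ) := by
  have hind := hL.indep φ.n φ.knot φ.strictMono_knot.monotone
  have hmeas : ∀ i : Fin φ.n, Measurable
      (fun ω => L (φ.knot i.succ) ω - L (φ.knot i.castSucc) ω) :=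
    fun i => (hL.measurable _).sub (hL.measurable _)
  have hind' : iIndepFun (fun (i : Fin φ.n) ω =>
      φ.coeff i * (L (φ.knot i.succ) ω - L (φ.knot i.castSucc) ω)) P :=
    hind.comp (fun i x => φ.coeff i * x) fun i => measurable_const_mul _
  have hprod := hind'.charFun_map_fun_sum_eq_prod
    fun i => ((hmeas i).const_mul (φ.coeff i)).aemeasurable
  change charFun (P.map (fun ω => ∑ i, _)) θ = _
  rw [hprod, Finset.prod_apply]
  have hterm : ∀ i : Fin φ.n, charFun (P.map (fun ω =>
      φ.coeff i * (L (φ.knot i.succ) ω - L (φ.knot i.castSucc) ω))) θ =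
      (Real.exp (-(|φ.coeff i| ^ α * (φ.knot i.succ - φ.knot i.castSucc) * |θ| ^ α)) : ℂ) := by
    intro i
    rw [charFun_map_mul_comp (hmeas i).aemeasurable, hL.charFun_increment _ _
      (φ.strictMono_knot Fin.castSucc_lt_succ).le, abs_mul,
      Real.mul_rpow (abs_nonneg _) (abs_nonneg _)]
    congr 3
    ring
  simp_rw [hterm]
  rw [← Complex.ofReal_prod, ← Real.exp_sum, Real.mul_rpow ENNReal.toReal_nonneg (abs_nonneg _),
    φ.eLpNorm_eval hα, Finset.sum_neg_distrib, Finset.sum_mul]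

variable [IsProbabilityMeasure P]

/-- A tail is controlled by the mean of `1 - charFun` over `|t| ≤ 2/r`, and here `1 - exp(-u) ≤ u`.
This is the continuity of the elementary integral from `L^α` to convergence in probability. -/
lemma IsStableMotion.measureReal_stochIntegral_gt_le (hL : IsStableMotion α L P) (hα : 0 < α)
    (φ : StepFunction) {r : ℝ} (hr : 0 < r) :
    P.real {ω | r < |φ.stochIntegral L ω|} ≤
      2 * ((eLpNorm φ.eval (ENNReal.ofReal α) volume).toReal * (2 * r⁻¹)) ^ α := by
  have hm := φ.measurable_stochIntegral hL.measurable
  set N := (eLpNorm φ.eval (ENNReal.ofReal α) volume).toReal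
  have hN : 0 ≤ N := ENNReal.toReal_nonneg
  have : IsProbabilityMeasure (P.map (φ.stochIntegral L)) :=
    Measure.isProbabilityMeasure_map hm.aemeasurable
  have h := measureReal_abs_gt_le_integral_charFun (μ := P.map (φ.stochIntegral L)) hr
  rw [map_measureReal_apply hm (s := {x : ℝ | r < |x|})
    (measurableSet_lt measurable_const measurable_norm)] at h
  refine h.trans ?_
  have hb : ‖∫ t in -2 * r⁻¹..2 * r⁻¹, 1 - charFun (P.map (φ.stochIntegral L)) t‖ ≤
      (N * (2 * r⁻¹)) ^ α * |2 * r⁻¹ - -2 * r⁻¹| := by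
    refine intervalIntegral.norm_integral_le_of_norm_le_const fun t ht => ?_
    have hr' : 0 < r⁻¹ := inv_pos.2 hr
    rw [Set.uIoc_of_le (by linarith)] at ht
    have ht' : |t| ≤ 2 * r⁻¹ := abs_le.2 ⟨by linarith [ht.1], ht.2⟩
    rw [hL.charFun_stochIntegral hα, ← Complex.ofReal_one, ← Complex.ofReal_sub,
      Complex.norm_real, Real.norm_eq_abs]
    have h0 : 0 ≤ (N * |t|) ^ α := by positivity
    have h1 : Real.exp (-(N * |t|) ^ α) ≤ 1 := Real.exp_le_one_iff.2 (by linarith)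
    rw [abs_of_nonneg (by linarith)]
    calc _ ≤ (N * |t|) ^ α := by linarith [Real.add_one_le_exp (-(N * |t|) ^ α)]
      _ ≤ _ := by gcongr
  calc _ ≤ 2⁻¹ * r * ((N * (2 * r⁻¹)) ^ α * |2 * r⁻¹ - -2 * r⁻¹|) := by gcongr
    _ = _ := by
      rw [show 2 * r⁻¹ - -2 * r⁻¹ = 4 * r⁻¹ by ring, abs_of_pos (by positivity)]
      field_simp
      ring

lemma IsStableMotion.tendstoInMeasure_stochIntegral_sub (hL : IsStableMotion α L P) (hα : 1 < α)
    (φ ψ : ℕ → StepFunction)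
    (h : Tendsto (fun k => eLpNorm (fun x => (φ k).eval x - (ψ k).eval x) (ENNReal.ofReal α) volume)
      atTop (𝓝 0)) :
    TendstoInMeasure P (fun k ω => (φ k).stochIntegral L ω - (ψ k).stochIntegral L ω) atTop
      (fun _ => 0) := by
  choose χ hχ1 hχ2 using fun k => exists_stepFunction_sub Ω (φ k) (ψ k)
  rw [tendstoInMeasure_iff_measureReal_norm]
  intro ε hε
  have h' : Tendsto (fun k => 2 * ((eLpNorm (χ k).eval (ENNReal.ofReal α) volume).toReal *
      (2 * (ε / 2)⁻¹)) ^ α) atTop (𝓝 0) := by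
    have e : ∀ k, (χ k).eval = fun x => (φ k).eval x - (ψ k).eval x := fun k => funext (hχ1 k)
    simp_rw [e]
    have h1 := ((ENNReal.tendsto_toReal ENNReal.zero_ne_top).comp h).mul_const (2 * (ε / 2)⁻¹)
    have h2 := (h1.rpow_const (p := α) (Or.inr (by linarith))).const_mul 2
    simpa [Real.zero_rpow (show α ≠ 0 by linarith)] using h2
  refine squeeze_zero (fun _ => measureReal_nonneg) (fun k => ?_) h'
  refine le_trans ?_ (hL.measureReal_stochIntegral_gt_le (by linarith) (χ k) (half_pos hε))
  refine measureReal_mono (fun ω hω => ?_)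
  simp only [Set.mem_ofPred_eq, sub_zero, Real.norm_eq_abs] at hω ⊢
  rw [hχ2]
  linarith

/-- Borel–Cantelli: almost surely the increments are eventually at most `2^(-k)`, so the sequence is
Cauchy and converges a.s., hence in measure. -/
lemma exists_tendstoInMeasure_of_summable_measureReal {X : ℕ → Ω → ℝ} (hX : ∀ k, Measurable (X k))
    (h : ∀ k, P.real {ω | (1 / 2 : ℝ) ^ k < |X (k + 1) ω - X k ω|} ≤ (1 / 2) ^ k) :
    ∃ Z : Ω → ℝ, Measurable Z ∧ TendstoInMeasure P X atTop Z := by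
  have hsum : ∑' k, P {ω | (1 / 2 : ℝ) ^ k < |X (k + 1) ω - X k ω|} ≠ ⊤ := by
    have h' : ∀ k, P {ω | (1 / 2 : ℝ) ^ k < |X (k + 1) ω - X k ω|} ≤
        ENNReal.ofReal ((1 / 2) ^ k) := fun k =>
      (ENNReal.le_ofReal_iff_toReal_le (measure_ne_top _ _) (by positivity)).2 (h k)
    refine ne_top_of_le_ne_top ?_ (ENNReal.tsum_le_tsum h')
    exact (summable_geometric_of_lt_one (by norm_num) (by norm_num)).tsum_ofReal_ne_top
  have hae : ∀ᵐ ω ∂P, ∃ l, Tendsto (fun k => X k ω) atTop (𝓝 l) := by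
    filter_upwards [ae_eventually_notMem hsum] with ω hω
    refine cauchySeq_tendsto_of_complete ?_
    obtain ⟨K, hK⟩ := eventually_atTop.1 hω
    rw [← cauchySeq_shift K]
    refine cauchySeq_of_le_geometric (1 / 2) 1 (by norm_num) fun n => ?_
    have := hK (n + K) (by omega)
    simp only [not_lt] at this
    rw [dist_comm, Real.dist_eq, one_mul, show n + 1 + K = n + K + 1 by ring]
    exact this.trans (pow_le_pow_of_le_one (by norm_num) (by norm_num) (by omega))
  obtain ⟨Z, hZm, hZ⟩ := measurable_limit_of_tendsto_metrizable_ae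
    (fun k => (hX k).aemeasurable) hae
  exact ⟨Z, hZm, tendstoInMeasure_of_tendsto_ae (fun k => (hX k).aestronglyMeasurable) hZ⟩

lemma tendstoInMeasure_add {X Y : ℕ → Ω → ℝ} {Z W : Ω → ℝ}
    (hX : TendstoInMeasure P X atTop Z) (hY : TendstoInMeasure P Y atTop W) :
    TendstoInMeasure P (fun k ω => X k ω + Y k ω) atTop (fun ω => Z ω + W ω) := by
  rw [tendstoInMeasure_iff_measureReal_norm] at *
  intro ε hε
  have h := (hX (ε / 2) (half_pos hε)).add (hY (ε / 2) (half_pos hε))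
  rw [add_zero] at h
  refine squeeze_zero (fun _ => measureReal_nonneg) (fun k => ?_) h
  refine le_trans (measureReal_mono fun ω hω => ?_) (measureReal_union_le _ _)
  simp only [Set.mem_ofPred_eq, Set.mem_union] at hω ⊢
  by_contra! hcon
  have := norm_add_le (X k ω - Z ω) (Y k ω - W ω)
  rw [show X k ω - Z ω + (Y k ω - W ω) = X k ω + Y k ω - (Z ω + W ω) by ring] at this
  linarith [hcon.1, hcon.2]

lemma tendstoInMeasure_const_mul {X : ℕ → Ω → ℝ} {Z : Ω → ℝ} (c : ℝ)
    (hX : TendstoInMeasure P X atTop Z) :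
    TendstoInMeasure P (fun k ω => c * X k ω) atTop (fun ω => c * Z ω) := by
  rw [tendstoInMeasure_iff_measureReal_norm] at *
  intro ε hε
  -- Dividing by `|c| + 1` rather than `|c|` covers `c = 0`.
  refine squeeze_zero (fun _ => measureReal_nonneg) (fun k => measureReal_mono fun ω hω => ?_)
    (hX (ε / (|c| + 1)) (by positivity))
  simp only [Set.mem_ofPred_eq, ← mul_sub, norm_mul, Real.norm_eq_abs c] at hω ⊢
  rw [div_le_iff₀ (by positivity)]
  nlinarith [norm_nonneg (X k ω - Z ω)]

lemma tendstoInMeasure_sum_const_mul {ι : Type*} (s : Finset ι) (a : ι → ℝ)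
    {X : ι → ℕ → Ω → ℝ} {Z : ι → Ω → ℝ} (hX : ∀ i, TendstoInMeasure P (X i) atTop (Z i)) :
    TendstoInMeasure P (fun k ω => ∑ i ∈ s, a i * X i k ω) atTop
      (fun ω => ∑ i ∈ s, a i * Z i ω) := by
  classical
  induction s using Finset.induction_on with
  | empty =>
    rw [tendstoInMeasure_iff_measureReal_norm]
    intro ε hε
    simp [hε.not_ge]
  | insert i s hi ih =>
    simp_rw [Finset.sum_insert hi]
    exact tendstoInMeasure_add (tendstoInMeasure_const_mul _ (hX i)) ih

end

/-! ### Density of step functions in `L^p` -/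

/-- The step function with value `f(tᵢ)` on `(tᵢ, tᵢ₊₁]`, for the equidistant partition of
`(-N, N]` of mesh `1 / m`. -/
def sampleStep (f : ℝ → ℝ) (N m : ℕ) : StepFunction where
  n := 2 * N * (m + 1)
  knot i := -N + i / (m + 1)
  strictMono_knot i j h := by
    have : (i : ℝ) < j := by exact_mod_cast h
    have hm : (0 : ℝ) < m + 1 := by positivity
    have := (div_lt_div_iff_of_pos_right hm).2 this
    simpa using this
  coeff i := f (-N + i / (m + 1))

lemma exists_sampleStep_eval_eq (f : ℝ → ℝ) (N m : ℕ) {x : ℝ} (hx : x ∈ Set.Ioc (-N : ℝ) N) :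
    ∃ y, |y - x| ≤ 1 / (m + 1) ∧ (sampleStep f N m).eval x = f y := by
  have hm : (0 : ℝ) < m + 1 := by positivity
  -- The cells are open on the left and closed on the right, so the ceiling gives the index of the
  -- right endpoint of the cell containing `x`; the sampled point `y` is the left endpoint.
  obtain ⟨j, hj⟩ : ∃ j, j = ⌈(x + N) * (m + 1)⌉₊ := ⟨_, rfl⟩
  have hpos : 0 < (x + N) * (m + 1) := mul_pos (by linarith [hx.1]) hm
  have hj0 : 0 < j := hj ▸ Nat.ceil_pos.2 hpos
  have hjle : j ≤ 2 * N * (m + 1) := by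
    refine hj ▸ Nat.ceil_le.2 ?_
    push_cast
    exact mul_le_mul_of_nonneg_right (by linarith [hx.2]) hm.le
  have h1 : (x + N) * (m + 1) ≤ j := hj ▸ Nat.le_ceil _
  have h2 : (j : ℝ) < (x + N) * (m + 1) + 1 := hj ▸ Nat.ceil_lt_add_one hpos.le
  obtain ⟨i, rfl⟩ : ∃ i, j = i + 1 := ⟨j - 1, by omega⟩
  push_cast at h1 h2
  have hlow : (i : ℝ) / (m + 1) < x + N := by rw [div_lt_iff₀ hm]; linarith
  have hup : x + N ≤ ((i : ℝ) + 1) / (m + 1) := by rw [le_div_iff₀ hm]; linarith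
  refine ⟨-N + i / (m + 1), ?_, ?_⟩
  · rw [add_div] at hup
    rw [abs_le]
    constructor <;> linarith
  · refine (sampleStep f N m).eval_eq_coeff (i := (⟨i, hjle⟩ : Fin (2 * N * (m + 1)))) ?_
    constructor
    · change -(N : ℝ) + (i : ℝ) / (m + 1) < x
      linarith
    · change x ≤ -(N : ℝ) + ((i + 1 : ℕ) : ℝ) / (m + 1)
      push_cast
      linarith

lemma sampleStep_eval_eq_zero (f : ℝ → ℝ) (N m : ℕ) {x : ℝ} (hx : x ∉ Set.Ioc (-N : ℝ) N) :
    (sampleStep f N m).eval x = 0 := by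
  have hm : (0 : ℝ) < m + 1 := by positivity
  refine StepFunction.eval_eq_zero _ fun i hi => hx ⟨lt_of_le_of_lt ?_ hi.1, hi.2.trans ?_⟩
  · change -(N : ℝ) ≤ -(N : ℝ) + _ / (m + 1)
    simp only [le_add_iff_nonneg_right]
    positivity
  · change -(N : ℝ) + ((i.succ : ℕ) : ℝ) / (m + 1) ≤ N
    have : ((i.succ : ℕ) : ℝ) ≤ 2 * N * (m + 1) := by
      have : (i.succ : ℕ) ≤ 2 * N * (m + 1) := Nat.le_of_lt_succ i.succ.2
      exact_mod_cast this
    have : ((i.succ : ℕ) : ℝ) / (m + 1) ≤ 2 * N := by rwa [div_le_iff₀ hm]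
    linarith

lemma exists_stepFunction_eLpNorm_sub_le_of_continuous {f : ℝ → ℝ} (hf : Continuous f)
    (hs : HasCompactSupport f) {p : ENNReal} {ε : ENNReal} (hε : ε ≠ 0) :
    ∃ φ : StepFunction, eLpNorm (fun x => φ.eval x - f x) p volume ≤ ε := by
  obtain ⟨R, hR⟩ := hs.isCompact.isBounded.subset_closedBall 0
  obtain ⟨N, hN⟩ := exists_nat_gt (max R 0)
  have hN0 : (0 : ℝ) < N := (le_max_right _ _).trans_lt hN
  have hfz : ∀ x, x ∉ Set.Ioc (-N : ℝ) N → f x = 0 := by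
    intro x hx
    by_contra hne
    have h1 := hR (subset_tsupport f hne)
    rw [Metric.mem_closedBall, dist_zero_right, Real.norm_eq_abs, abs_le] at h1
    have := le_max_left R 0
    exact hx ⟨by linarith, by linarith⟩
  have hM : volume (Set.Ioc (-N : ℝ) N) ^ p.toReal⁻¹ ≠ ⊤ := by
    refine ENNReal.rpow_ne_top_of_nonneg (by positivity) (by simp)
  -- A uniform error `δ` on `(-N, N]` costs at most `ε` in `L^p`.
  obtain ⟨δ, hδ0, hδ⟩ : ∃ δ : ℝ, 0 < δ ∧
      volume (Set.Ioc (-N : ℝ) N) ^ p.toReal⁻¹ * ENNReal.ofReal δ ≤ ε := by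
    obtain ⟨c, hc0, hc⟩ := ENNReal.exists_nnreal_pos_mul_lt hM hε
    exact ⟨c, hc0, by rw [ENNReal.ofReal_coe_nnreal, mul_comm]; exact hc.le⟩
  obtain ⟨η, hη0, hη⟩ := Metric.uniformContinuous_iff.1 (hs.uniformContinuous_of_continuous hf) δ hδ0
  obtain ⟨m, hm⟩ := exists_nat_one_div_lt hη0
  refine ⟨sampleStep f N m, ?_⟩
  rw [← eLpNorm_restrict_eq_of_support_subset (s := Set.Ioc (-N : ℝ) N)]
  · refine (eLpNorm_le_of_ae_bound (C := δ) ?_).trans (by simpa using hδ)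
    refine (ae_restrict_iff' measurableSet_Ioc).2 (Eventually.of_forall fun x hx => ?_)
    obtain ⟨y, hy, hxy⟩ := exists_sampleStep_eval_eq f N m hx
    rw [hxy, ← dist_eq_norm]
    exact (hη (by rw [Real.dist_eq]; exact hy.trans_lt hm)).le
  · intro x hx
    by_contra hxn
    exact hx (by simp [sampleStep_eval_eq_zero f N m hxn, hfz x hxn])

/-- Step functions are dense in `L^p`. -/
lemma exists_stepFunction_eLpNorm_sub_le {f : ℝ → ℝ} {p : ENNReal} (hp1 : 1 ≤ p) (hp : p ≠ ⊤)
    (hf : MemLp f p volume) {ε : ENNReal} (hε : ε ≠ 0) :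
    ∃ φ : StepFunction, eLpNorm (fun x => φ.eval x - f x) p volume ≤ ε := by
  have hε2 : ε / 2 ≠ 0 := by simpa using hε
  obtain ⟨u, hus, hu, huc, hum⟩ := hf.exists_hasCompactSupport_eLpNorm_sub_le hp hε2
  obtain ⟨φ, hφ⟩ := exists_stepFunction_eLpNorm_sub_le_of_continuous huc hus (p := p) hε2
  refine ⟨φ, ?_⟩
  have := eLpNorm_sub_le (μ := volume)
    (φ.measurable_eval.aestronglyMeasurable.sub hum.aestronglyMeasurable)
    (hf.aestronglyMeasurable.sub hum.aestronglyMeasurable) hp1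
  rw [sub_sub_sub_cancel_right] at this
  exact this.trans ((add_le_add hφ hu).trans (ENNReal.add_halves ε).le)

lemma exists_stepFunction_tendsto {f : ℝ → ℝ} {p : ENNReal} (hp1 : 1 ≤ p) (hp : p ≠ ⊤)
    (hf : MemLp f p volume) : ∃ ψ : ℕ → StepFunction,
      Tendsto (fun k => eLpNorm (fun x => (ψ k).eval x - f x) p volume) atTop (𝓝 0) := by
  choose ψ hψ using fun k : ℕ => exists_stepFunction_eLpNorm_sub_le hp1 hp hf
    (ENNReal.inv_ne_zero.2 (ENNReal.natCast_ne_top k))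
  exact ⟨ψ, tendsto_of_tendsto_of_tendsto_of_le_of_le tendsto_const_nhds
    ENNReal.tendsto_inv_nat_nhds_zero (fun _ => zero_le) hψ⟩

/-! ### Stable integrals: shifts, existence, joint laws, stationarity -/

section

variable {Ω : Type*} [MeasurableSpace Ω] {P : Measure Ω} {α : ℝ} {L : ℝ → Ω → ℝ}

/-- The increments of a stable motion after time `h` form a stable motion. -/
lemma IsStableMotion.shift (hL : IsStableMotion α L P) (h : ℝ) :
    IsStableMotion α (fun t ω => L (t + h) ω - L h ω) P where
  measurable t := (hL.measurable _).sub (hL.measurable _)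
  zero := by simp
  indep n t ht := by
    simpa using hL.indep n (fun i => t i + h) (ht.add_const h)
  charFun_increment s t hst θ := by
    simpa using hL.charFun_increment (s + h) (t + h) (by linarith) θ

/-- The step function `x ↦ φ(x - h)`. -/
def StepFunction.shift (φ : StepFunction) (h : ℝ) : StepFunction where
  n := φ.n
  knot i := φ.knot i + h
  strictMono_knot := φ.strictMono_knot.add_const h
  coeff := φ.coeff

lemma StepFunction.eval_shift (φ : StepFunction) (h x : ℝ) :
    (φ.shift h).eval x = φ.eval (x - h) := by
  simp only [eval, shift, Set.indicator_apply, Set.mem_Ioc, lt_sub_iff_add_lt, sub_le_iff_le_add]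
  rfl

lemma StepFunction.stochIntegral_shift {Ω : Type*} {L : ℝ → Ω → ℝ} (φ : StepFunction) (h : ℝ) (ω : Ω) :
    (φ.shift h).stochIntegral L ω = φ.stochIntegral (fun t ω => L (t + h) ω - L h ω) ω := by
  simp only [stochIntegral, shift, sub_sub_sub_cancel_right]
  rfl

/-- Translating approximants of `f(· + h)` gives approximants of `f` whose integrals against `L`
equal the original ones against the shifted motion. The very same `Z` therefore serves for both. -/
lemma IsStableIntegral.shift {f : ℝ → ℝ} {Z : Ω → ℝ} (hZ : IsStableIntegral α L P f Z) (h : ℝ) :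
    IsStableIntegral α (fun t ω => L (t + h) ω - L h ω) P (fun x => f (x + h)) Z where
  memLp := hZ.memLp.comp_measurePreserving (measurePreserving_add_right volume h)
  measurable := hZ.measurable
  tendsto φ hφ := by
    have := hZ.tendsto (fun k => (φ k).shift h) (hφ.congr fun k => ?_)
    · exact this.congr_left fun k => ae_of_all _ fun ω => StepFunction.stochIntegral_shift _ h ω
    · have hm : AEStronglyMeasurable (fun x => ((φ k).shift h).eval x - f x) volume :=
        ((φ k).shift h).measurable_eval.aestronglyMeasurable.sub hZ.memLp.aestronglyMeasurable
      rw [← eLpNorm_comp_measurePreserving hm (measurePreserving_add_right volume h)]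
      simp [Function.comp_def, StepFunction.eval_shift]

lemma IsStableIntegral.ae_eq {f : ℝ → ℝ} {Z Z' : Ω → ℝ} (hα : 1 < α)
    (hZ : IsStableIntegral α L P f Z) (hZ' : IsStableIntegral α L P f Z') : Z =ᵐ[P] Z' := by
  obtain ⟨ψ, hψ⟩ := exists_stepFunction_tendsto (by simpa using hα.le)
    ENNReal.ofReal_ne_top hZ.memLp
  exact tendstoInMeasure_ae_unique (hZ.tendsto ψ hψ) (hZ'.tendsto ψ hψ)

variable [IsProbabilityMeasure P]

/-- Every function in `L^α` has a stable integral. -/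
lemma IsStableMotion.exists_isStableIntegral (hL : IsStableMotion α L P) (hα : 1 < α)
    {f : ℝ → ℝ} (hf : MemLp f (ENNReal.ofReal α) volume) :
    ∃ Z : Ω → ℝ, IsStableIntegral α L P f Z := by
  have hp : 1 ≤ ENNReal.ofReal α := by simpa using hα.le
  have htri : ∀ φ ψ : StepFunction,
      eLpNorm (fun x => φ.eval x - ψ.eval x) (ENNReal.ofReal α) volume ≤
        eLpNorm (fun x => φ.eval x - f x) (ENNReal.ofReal α) volume +
        eLpNorm (fun x => ψ.eval x - f x) (ENNReal.ofReal α) volume := by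
    intro φ ψ
    have := eLpNorm_sub_le (μ := volume)
      (φ.measurable_eval.aestronglyMeasurable.sub hf.aestronglyMeasurable)
      (ψ.measurable_eval.aestronglyMeasurable.sub hf.aestronglyMeasurable) hp
    rwa [sub_sub_sub_cancel_right] at this
  -- With `δ k = 2^(-(2k+4))`, the tail bound at level `2^(-k)` for a norm of at most `2 δ k` is `2
  -- (2^(-(k+2)))^α ≤ 2^(-k)`, using `α > 1`.
  obtain ⟨δ, hδ0, hδa, hδt, hδ⟩ : ∃ δ : ℕ → ℝ, (∀ k, 0 < δ k) ∧ Antitone δ ∧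
      Tendsto δ atTop (𝓝 0) ∧
      ∀ k, 2 * (2 * δ k * (2 * ((1 / 2 : ℝ) ^ k)⁻¹)) ^ α ≤ (1 / 2) ^ k := by
    refine ⟨fun k => (1 / 2) ^ (2 * k + 4), fun k => by positivity,
      fun i j h => pow_le_pow_of_le_one (by norm_num) (by norm_num) (by omega),
      (tendsto_pow_atTop_nhds_zero_of_lt_one (by norm_num) (by norm_num)).comp
        (tendsto_atTop_mono (fun k => by simp only [id]; omega) tendsto_id), fun k => ?_⟩
    have e : 2 * (1 / 2 : ℝ) ^ (2 * k + 4) * (2 * ((1 / 2 : ℝ) ^ k)⁻¹) = (1 / 2) ^ (k + 2) := by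
      have : ((1 / 2 : ℝ) ^ k) ≠ 0 := by positivity
      field_simp
      ring
    rw [e]
    have : ((1 / 2 : ℝ) ^ (k + 2)) ^ α ≤ ((1 / 2 : ℝ) ^ (k + 2)) ^ (1 : ℝ) :=
      Real.rpow_le_rpow_of_exponent_ge (by positivity)
        (pow_le_one₀ (by norm_num) (by norm_num)) hα.le
    rw [Real.rpow_one] at this
    have h0 : (0 : ℝ) < (1 / 2) ^ k := by positivity
    have h1 : (1 / 2 : ℝ) ^ (k + 2) = (1 / 2) ^ k / 4 := by rw [pow_add]; ring
    linarith
  choose ψ hψ using fun k => exists_stepFunction_eLpNorm_sub_le hp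
    ENNReal.ofReal_ne_top hf (ε := ENNReal.ofReal (δ k)) (by simpa using hδ0 k)
  obtain ⟨Z, hZm, hZ⟩ := exists_tendstoInMeasure_of_summable_measureReal (P := P)
    (X := fun k => (ψ k).stochIntegral L)
    (fun k => (ψ k).measurable_stochIntegral hL.measurable) fun k => by
      obtain ⟨χ, hχ1, hχ2⟩ := exists_stepFunction_sub Ω (ψ (k + 1)) (ψ k)
      simp_rw [← hχ2]
      refine (hL.measureReal_stochIntegral_gt_le (by linarith) χ (by positivity)).trans
        (le_trans ?_ (hδ k))
      have hle : eLpNorm χ.eval (ENNReal.ofReal α) volume ≤ ENNReal.ofReal (2 * δ k) := by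
        rw [show χ.eval = fun x => (ψ (k + 1)).eval x - (ψ k).eval x from funext hχ1, two_mul,
          ENNReal.ofReal_add (hδ0 k).le (hδ0 k).le]
        exact (htri _ _).trans (add_le_add
          ((hψ _).trans (ENNReal.ofReal_le_ofReal (hδa (Nat.le_succ k)))) (hψ k))
      have hle' := ENNReal.toReal_le_of_le_ofReal (by linarith [hδ0 k]) hle
      gcongr
  have hψt : Tendsto (fun k => eLpNorm (fun x => (ψ k).eval x - f x) (ENNReal.ofReal α) volume)
      atTop (𝓝 0) := by
    have : Tendsto (fun k => ENNReal.ofReal (δ k)) atTop (𝓝 0) := by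
      simpa using ENNReal.tendsto_ofReal hδt
    exact tendsto_of_tendsto_of_tendsto_of_le_of_le tendsto_const_nhds this
      (fun _ => zero_le) hψ
  refine ⟨Z, hf, hZm, fun φ hφ => ?_⟩
  -- An arbitrary approximating sequence differs from `ψ` by a null sequence in `L^α`, so its
  -- integrals have the same limit.
  have hsub := hL.tendstoInMeasure_stochIntegral_sub hα φ ψ
    (tendsto_of_tendsto_of_tendsto_of_le_of_le tendsto_const_nhds
      (by simpa using hφ.add hψt) (fun _ => zero_le) fun k => htri (φ k) (ψ k))
  simpa using tendstoInMeasure_add hsub hZ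

lemma tendsto_charFun_map_of_tendstoInMeasure {X : ℕ → Ω → ℝ} {Z : Ω → ℝ}
    (hX : ∀ k, Measurable (X k)) (h : TendstoInMeasure P X atTop Z) (θ : ℝ) :
    Tendsto (fun k => charFun (P.map (X k)) θ) atTop (𝓝 (charFun (P.map Z) θ)) :=
  ProbabilityMeasure.tendsto_iff_tendsto_charFun.1
    (h.tendstoInDistribution fun k => (hX k).aemeasurable).tendsto θ

/-- The joint law of stable integrals depends only on the integrands, not on the stable motion. -/
lemma identDistrib_of_isStableIntegral {L' : ℝ → Ω → ℝ} (hα : 1 < α) (hL : IsStableMotion α L P)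
    (hL' : IsStableMotion α L' P) {n : ℕ} {f : Fin n → ℝ → ℝ} {Z Z' : Fin n → Ω → ℝ}
    (hZ : ∀ i, IsStableIntegral α L P (f i) (Z i))
    (hZ' : ∀ i, IsStableIntegral α L' P (f i) (Z' i)) :
    IdentDistrib (fun ω i => Z i ω) (fun ω i => Z' i ω) P P := by
  have hm : Measurable (fun ω i => Z i ω) := measurable_pi_lambda _ fun i => (hZ i).measurable
  have hm' : Measurable (fun ω i => Z' i ω) := measurable_pi_lambda _ fun i => (hZ' i).measurable
  have := Measure.isProbabilityMeasure_map (μ := P) hm.aemeasurable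
  have := Measure.isProbabilityMeasure_map (μ := P) hm'.aemeasurable
  refine ⟨hm.aemeasurable, hm'.aemeasurable, Measure.ext_of_charFunDual (funext fun A => ?_)⟩
  -- Cramér–Wold: the characteristic function at `A` is that of one linear combination of the
  -- coordinates, at `1`.
  have hA : ∀ v : Fin n → ℝ, A v = ∑ i, A (Pi.single i 1) * v i := by
    intro v
    conv_lhs => rw [← Finset.univ_sum_single v]
    rw [map_sum]
    refine Finset.sum_congr rfl fun i _ => ?_
    rw [mul_comm, ← smul_eq_mul, ← map_smul, ← Pi.single_smul, smul_eq_mul, mul_one]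
  rw [charFunDual_eq_charFun_map_one, charFunDual_eq_charFun_map_one,
    Measure.map_map (by fun_prop) hm, Measure.map_map (by fun_prop) hm']
  rw [show A ∘ (fun ω i => Z i ω) = fun ω => ∑ i, A (Pi.single i 1) * Z i ω from
      funext fun ω => hA _,
    show A ∘ (fun ω i => Z' i ω) = fun ω => ∑ i, A (Pi.single i 1) * Z' i ω from
      funext fun ω => hA _]
  choose ψ hψ using fun i => exists_stepFunction_tendsto (by simpa using hα.le)
    ENNReal.ofReal_ne_top (hZ i).memLp
  -- The step function `χ k` is chosen before any motion, so the same norms determine the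
  -- characteristic functions for `L` and for `L'`.
  choose χ _ hχ using fun k => exists_stepFunction_sum Ω (fun i => A (Pi.single i 1))
    (fun i => ψ i k)
  have lim : ∀ {M : ℝ → Ω → ℝ} {W : Fin n → Ω → ℝ}, IsStableMotion α M P →
      (∀ i, IsStableIntegral α M P (f i) (W i)) →
      Tendsto (fun k => (Real.exp (-((eLpNorm (χ k).eval (ENNReal.ofReal α) volume).toReal
        * |1|) ^ α) : ℂ)) atTop
        (𝓝 (charFun (P.map (fun ω => ∑ i, A (Pi.single i 1) * W i ω)) 1)) := by
    intro M W hM hW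
    refine Tendsto.congr (fun k => hM.charFun_stochIntegral (by linarith) (χ k) 1) ?_
    refine tendsto_charFun_map_of_tendstoInMeasure
      (fun k => (χ k).measurable_stochIntegral hM.measurable) ?_ 1
    rw [show (fun k => (χ k).stochIntegral M) = fun k ω =>
      ∑ i, A (Pi.single i 1) * (ψ i k).stochIntegral M ω from
      funext fun k => funext fun ω => hχ k M ω]
    exact tendstoInMeasure_sum_const_mul _ _ fun i => (hW i).tendsto (ψ i) (hψ i)
  exact tendsto_nhds_unique (lim hL hZ) (lim hL' hZ')

lemma IsFIMAProcess.isStationary {d : ℝ} {g : ℝ → ℝ} {Y : ℝ → Ω → ℝ} (hα : 1 < α)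
    (hL : IsStableMotion α L P) (hY : IsFIMAProcess α d g L P Y) : IsStationary Y P := by
  intro n t h
  refine identDistrib_of_isStableIntegral hα (hL.shift h) hL (fun i => ?_) fun i => hY (t i)
  convert (hY (t i + h)).shift h using 2 with x
  simp only [Set.indicator_apply, Set.mem_Iic, add_le_add_iff_right, add_sub_add_right_eq_sub]

end

/-! ### Convergence and decay of the fractional integral -/

section

lemma integrableOn_Ioc_sub_rpow {d : ℝ} (hd : 0 < d) (a x : ℝ) :
    IntegrableOn (fun t => (x - t) ^ (d - 1)) (Set.Ioc a x) volume := by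
  rcases le_or_gt a x with hax | hax
  · have h := (intervalIntegral.intervalIntegrable_rpow' (a := 0) (b := x - a) (r := d - 1)
      (by linarith)).comp_sub_left x
    rw [sub_zero, sub_sub_cancel] at h
    exact (intervalIntegrable_iff_integrableOn_Ioc_of_le hax).1 h.symm
  · simp [Set.Ioc_eq_empty_of_le hax.le]

lemma integral_Ioc_sub_rpow {d : ℝ} (hd : 0 < d) {a x : ℝ} (hax : a ≤ x) :
    ∫ t in Set.Ioc a x, (x - t) ^ (d - 1) = (x - a) ^ d / d := by
  rw [← intervalIntegral.integral_of_le hax,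
    intervalIntegral.integral_comp_sub_left (fun u => u ^ (d - 1)) x, sub_self,
    integral_rpow (Or.inl (by linarith))]
  simp [Real.zero_rpow hd.ne']

variable {d C c : ℝ} {g : ℝ → ℝ}

/-- The value `g 0` is unrestricted, but a single point is null. -/
lemma setIntegral_Iic_eq_Ioc (hg0 : ∀ t < 0, g t = 0) (x : ℝ) (w : ℝ → ℝ) :
    ∫ t in Set.Iic x, g t * w t = ∫ t in Set.Ioc 0 x, g t * w t := by
  rw [← integral_indicator measurableSet_Iic, ← integral_indicator measurableSet_Ioc]
  refine integral_congr_ae ?_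
  filter_upwards [compl_mem_ae_iff.2 (measure_singleton (0 : ℝ))] with t ht
  have ht : t ≠ 0 := ht
  simp only [Set.indicator_apply, Set.mem_Iic, Set.mem_Ioc]
  rcases lt_or_gt_of_ne ht with h | h
  · simp [hg0 t h]
  · simp [h]

lemma integrableOn_mul_sub_rpow (hd : 0 < d) (hg : Measurable g) (hg0 : ∀ t < 0, g t = 0)
    (hc : 0 < c) (hgC : ∀ t, |g t| ≤ C * Real.exp (-c * t)) (x : ℝ) :
    IntegrableOn (fun t => g t * (x - t) ^ (d - 1)) (Set.Iic x) volume := by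
  have hm : Measurable fun t => g t * (x - t) ^ (d - 1) := by fun_prop
  -- Cutting at `-1` rather than `0` makes `g` vanish on all of the left piece; on the right piece
  -- `|g| ≤ C e^c`.
  have h1 : IntegrableOn (fun t => g t * (x - t) ^ (d - 1)) (Set.Ioc (-1) x) volume := by
    refine ((integrableOn_Ioc_sub_rpow hd (-1) x).const_mul (C * Real.exp c)).mono'
      hm.aestronglyMeasurable ?_
    refine (ae_restrict_iff' measurableSet_Ioc).2 (ae_of_all _ fun t ht => ?_)
    have hC : 0 ≤ C := by simpa using (abs_nonneg _).trans (hgC 0)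
    have hpos : 0 ≤ (x - t) ^ (d - 1) := Real.rpow_nonneg (by linarith [ht.2]) _
    rw [norm_mul, Real.norm_eq_abs, Real.norm_of_nonneg hpos]
    refine mul_le_mul_of_nonneg_right ((hgC t).trans ?_) hpos
    gcongr
    nlinarith [ht.1]
  have h2 : IntegrableOn (fun t => g t * (x - t) ^ (d - 1)) (Set.Iic (-1)) volume :=
    integrableOn_zero.congr_fun (fun t ht => by
      have : t ≤ -1 := ht
      simp [hg0 t (by linarith)]) measurableSet_Iic
  refine (h2.union h1).mono_set fun t ht => ?_
  rcases le_or_gt t (-1) with h | h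
  · exact Or.inl h
  · exact Or.inr ⟨h, ht⟩

/-- An indicator replaces the moving domain by a jointly measurable integrand, whose partial
integral is measurable. -/
lemma measurable_fracIntegralLeft (hg : Measurable g) : Measurable (fracIntegralLeft d g) := by
  have h : Measurable (fun q : ℝ × ℝ =>
      (Set.Iic q.1).indicator (fun t => g t * (q.1 - t) ^ (d - 1)) q.2) := by
    have e : (fun q : ℝ × ℝ => (Set.Iic q.1).indicator (fun t => g t * (q.1 - t) ^ (d - 1)) q.2) =
        {q : ℝ × ℝ | q.2 ≤ q.1}.indicator (fun q => g q.2 * (q.1 - q.2) ^ (d - 1)) := by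
      ext q; simp [Set.indicator_apply]
    rw [e]
    exact Measurable.indicator (by fun_prop) (measurableSet_le measurable_snd measurable_fst)
  have := (h.stronglyMeasurable.integral_prod_right' (ν := volume)).measurable
  unfold fracIntegralLeft
  simp_rw [← integral_indicator measurableSet_Iic]
  exact this.const_mul _

/-- Split at `x / 2`: on the left half the kernel is at most `(x/2)^(d-1)` and the exponential
integrates to at most `1/c`; on the right half the exponential is at most `e^(-cx/2)` and the kernel
integrates to `(x/2)^d / d`. -/
lemma abs_setIntegral_le (hd : 0 < d) (hd1 : d < 1)
    (hc : 0 < c) (hgC : ∀ t, |g t| ≤ C * Real.exp (-c * t)) {x : ℝ} (hx : 0 < x) :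
    |∫ t in Set.Ioc 0 x, g t * (x - t) ^ (d - 1)| ≤
      C * ((x / 2) ^ (d - 1) / c + Real.exp (-c * (x / 2)) * ((x / 2) ^ d / d)) := by
  have hC : 0 ≤ C := by simpa using (abs_nonneg _).trans (hgC 0)
  have hint : ∀ a, IntegrableOn (fun t => (x - t) ^ (d - 1)) (Set.Ioc a x) volume :=
    fun a => integrableOn_Ioc_sub_rpow hd a x
  have hexp : IntegrableOn (fun t => Real.exp (-c * t)) (Set.Ioi 0) volume :=
    integrableOn_exp_mul_Ioi (by linarith) 0
  have hexp' : IntegrableOn (fun t => Real.exp (-c * t)) (Set.Ioc 0 (x / 2)) volume :=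
    hexp.mono_set Set.Ioc_subset_Ioi_self
  have hbound : ∀ t ∈ Set.Ioc 0 x, ‖g t * (x - t) ^ (d - 1)‖ ≤
      C * ((x / 2) ^ (d - 1) * (Set.Ioc 0 (x / 2)).indicator (fun t => Real.exp (-c * t)) t +
        Real.exp (-c * (x / 2)) * (Set.Ioc (x / 2) x).indicator (fun t => (x - t) ^ (d - 1)) t) := by
    intro t ht
    have hpos : 0 ≤ (x - t) ^ (d - 1) := Real.rpow_nonneg (by linarith [ht.2]) _
    rw [norm_mul, Real.norm_eq_abs, Real.norm_of_nonneg hpos]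
    refine (mul_le_mul_of_nonneg_right (hgC t) hpos).trans ?_
    rw [mul_assoc]
    refine mul_le_mul_of_nonneg_left ?_ hC
    rcases le_or_gt t (x / 2) with h | h
    · rw [Set.indicator_of_mem (show t ∈ Set.Ioc 0 (x / 2) from ⟨ht.1, h⟩),
        Set.indicator_of_notMem (fun h' => absurd h'.1 (not_lt.2 h)), mul_zero, add_zero, mul_comm]
      refine mul_le_mul_of_nonneg_right ?_ (Real.exp_pos _).le
      exact Real.rpow_le_rpow_of_nonpos (by linarith) (by linarith) (by linarith)
    · rw [Set.indicator_of_mem (show t ∈ Set.Ioc (x / 2) x from ⟨h, ht.2⟩),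
        Set.indicator_of_notMem (fun h' => absurd h'.2 (not_le.2 h)), mul_zero, zero_add]
      refine mul_le_mul_of_nonneg_right (Real.exp_le_exp.2 ?_) hpos
      nlinarith
  have hi1 : Integrable ((Set.Ioc 0 (x / 2)).indicator (fun t => Real.exp (-c * t))) volume :=
    hexp'.integrable_indicator measurableSet_Ioc
  have hi2 : Integrable ((Set.Ioc (x / 2) x).indicator (fun t => (x - t) ^ (d - 1))) volume :=
    (hint (x / 2)).integrable_indicator measurableSet_Ioc
  have hi := (((hi1.const_mul ((x / 2) ^ (d - 1))).add
    (hi2.const_mul (Real.exp (-c * (x / 2))))).const_mul C)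
  have hle := norm_integral_le_of_norm_le (hi.integrableOn (s := Set.Ioc 0 x))
    ((ae_restrict_iff' measurableSet_Ioc).2 (ae_of_all _ hbound))
  rw [Real.norm_eq_abs] at hle
  refine hle.trans ((setIntegral_le_integral hi (ae_of_all _ fun t => ?_)).trans ?_)
  · refine mul_nonneg hC (add_nonneg (mul_nonneg (by positivity) ?_) (mul_nonneg (by positivity) ?_))
    · exact Set.indicator_nonneg (fun _ _ => (Real.exp_pos _).le) _
    · exact Set.indicator_nonneg (fun t ht => Real.rpow_nonneg (by linarith [ht.2]) _) _
  · simp only [Pi.add_apply]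
    rw [integral_const_mul, integral_add (hi1.const_mul _) (hi2.const_mul _), integral_const_mul,
      integral_const_mul, integral_indicator measurableSet_Ioc, integral_indicator measurableSet_Ioc,
      integral_Ioc_sub_rpow hd (by linarith)]
    have he : ∫ t in Set.Ioc 0 (x / 2), Real.exp (-c * t) ≤ 1 / c := by
      refine (setIntegral_mono_set hexp (ae_of_all _ fun t => (Real.exp_pos _).le)
        Set.Ioc_subset_Ioi_self.eventuallyLE).trans ?_
      rw [integral_exp_mul_Ioi (by linarith)]
      simp
    rw [show x - x / 2 = x / 2 by ring, div_eq_mul_one_div _ c]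
    gcongr

/-- `I_+^d g` decays like `x ^ (d - 1)` at infinity and is bounded near the origin. -/
lemma exists_abs_fracIntegralLeft_le (hd : 0 < d) (hd1 : d < 1)
    (hg0 : ∀ t < 0, g t = 0) (hc : 0 < c) (hgC : ∀ t, |g t| ≤ C * Real.exp (-c * t)) :
    ∃ K, ∀ x, |fracIntegralLeft d g x| ≤ K * (1 + ‖x‖) ^ (d - 1) := by
  have hC : 0 ≤ C := by simpa using (abs_nonneg _).trans (hgC 0)
  have hΓ : 0 < 1 / Real.Gamma d := one_div_pos.2 (Real.Gamma_pos_of_pos hd)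
  suffices h : ∃ K, 0 ≤ K ∧ ∀ x, 0 < x → |∫ t in Set.Ioc 0 x, g t * (x - t) ^ (d - 1)| ≤
      K * (1 + x) ^ (d - 1) by
    obtain ⟨K, hK0, hK⟩ := h
    refine ⟨1 / Real.Gamma d * K, fun x => ?_⟩
    rw [fracIntegralLeft, setIntegral_Iic_eq_Ioc hg0, abs_mul, abs_of_pos hΓ, mul_assoc]
    refine mul_le_mul_of_nonneg_left ?_ hΓ.le
    rcases le_or_gt x 0 with hx | hx
    · rw [Set.Ioc_eq_empty_of_le hx]
      simp only [Measure.restrict_empty, integral_zero_measure, abs_zero]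
      positivity
    · rw [Real.norm_of_nonneg hx.le]
      exact hK x hx
  -- The two summands serve `x ≤ 1` and `x > 1`. The factor `1/4` works for both, since `(1 + x)/4`
  -- is at most `1` in the first case and at most `x/2` in the second; the negative exponent
  -- reverses these inequalities.
  refine ⟨C / d * (1 / 4) ^ (d - 1) + C * (1 / c + 1 / (c * d)) * (1 / 4) ^ (d - 1),
    by positivity, fun x hx => ?_⟩
  rw [add_mul]
  have hx1 : 0 < 1 + x := by linarith
  rcases le_or_gt x 1 with h | h
  · refine le_add_of_le_of_nonneg ?_ (by positivity)
    have h1 : |∫ t in Set.Ioc 0 x, g t * (x - t) ^ (d - 1)| ≤ C * (x ^ d / d) := by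
      rw [← Real.norm_eq_abs]
      refine (norm_integral_le_of_norm_le ((integrableOn_Ioc_sub_rpow hd 0 x).const_mul C)
        ((ae_restrict_iff' measurableSet_Ioc).2 (ae_of_all _ fun t ht => ?_))).trans ?_
      · have hpos : 0 ≤ (x - t) ^ (d - 1) := Real.rpow_nonneg (by linarith [ht.2]) _
        rw [norm_mul, Real.norm_eq_abs, Real.norm_of_nonneg hpos]
        refine mul_le_mul_of_nonneg_right ((hgC t).trans (mul_le_of_le_one_right hC ?_)) hpos
        exact Real.exp_le_one_iff.2 (by nlinarith [ht.1])
      · rw [integral_const_mul, integral_Ioc_sub_rpow hd hx.le, sub_zero]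
    have h2 : x ^ d ≤ 1 := Real.rpow_le_one hx.le h hd.le
    have h3 : 1 ≤ (1 / 4 * (1 + x)) ^ (d - 1) :=
      Real.one_le_rpow_of_pos_of_le_one_of_nonpos (by positivity) (by linarith) (by linarith)
    rw [mul_assoc, ← Real.mul_rpow (by norm_num) hx1.le]
    calc _ ≤ C * (x ^ d / d) := h1
      _ ≤ C * (1 / d) := by gcongr
      _ = C / d * 1 := by ring
      _ ≤ _ := by gcongr
  · refine le_add_of_nonneg_of_le (by positivity) ?_
    refine (abs_setIntegral_le hd hd1 hc hgC hx).trans ?_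
    have hy : 0 < x / 2 := by linarith
    have h1 : Real.exp (-c * (x / 2)) * ((x / 2) ^ d / d) ≤ (x / 2) ^ (d - 1) * (1 / (c * d)) := by
      have h2 : (x / 2) ^ d = (x / 2) ^ (d - 1) * (x / 2) := by
        rw [← Real.rpow_add_one hy.ne', sub_add_cancel]
      have h3 : x / 2 * Real.exp (-c * (x / 2)) ≤ 1 / c := by
        rw [neg_mul, Real.exp_neg, ← div_eq_mul_inv, div_le_div_iff₀ (Real.exp_pos _) hc]
        linarith [Real.add_one_le_exp (c * (x / 2))]
      calc _ = (x / 2) ^ (d - 1) * (x / 2 * Real.exp (-c * (x / 2)) / d) := by rw [h2]; ring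
        _ ≤ (x / 2) ^ (d - 1) * (1 / c / d) := by gcongr
        _ = _ := by rw [div_div]
    have h4 : (x / 2) ^ (d - 1) ≤ (1 / 4) ^ (d - 1) * (1 + x) ^ (d - 1) := by
      rw [← Real.mul_rpow (by norm_num) hx1.le]
      exact Real.rpow_le_rpow_of_nonpos (by positivity) (by linarith) (by linarith)
    calc _ ≤ C * ((x / 2) ^ (d - 1) / c + (x / 2) ^ (d - 1) * (1 / (c * d))) := by gcongr
      _ = C * (1 / c + 1 / (c * d)) * (x / 2) ^ (d - 1) := by ring
      _ ≤ C * (1 / c + 1 / (c * d)) * ((1 / 4) ^ (d - 1) * (1 + x) ^ (d - 1)) := by gcongr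
      _ = _ := by ring

lemma memLp_fracIntegralLeft {α : ℝ} (hα : 1 < α) (hd : 0 < d) (hd1 : d < 1 - 1 / α)
    (hg : Measurable g) (hg0 : ∀ t < 0, g t = 0) (hc : 0 < c)
    (hgC : ∀ t, |g t| ≤ C * Real.exp (-c * t)) :
    MemLp (fracIntegralLeft d g) (ENNReal.ofReal α) volume := by
  have hα0 : 0 < α := by linarith
  have hd1' : d < 1 := hd1.trans (sub_lt_self _ (by positivity))
  obtain ⟨K, hK⟩ := exists_abs_fracIntegralLeft_le hd hd1' hg0 hc hgC
  have hJ : MemLp (fun x : ℝ => (1 + ‖x‖) ^ (d - 1)) (ENNReal.ofReal α) volume := by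
    have hm : Measurable (fun x : ℝ => (1 + ‖x‖) ^ (d - 1)) := by fun_prop
    rw [← integrable_norm_rpow_iff hm.aestronglyMeasurable (by simpa using hα0)
      ENNReal.ofReal_ne_top, ENNReal.toReal_ofReal hα0.le]
    -- This is `d < 1 - 1/α` multiplied by `α`, the integrability threshold of `(1 + |x|)^(-(1-d)α)`
    -- on the line.
    have h1 : 1 < (1 - d) * α := by
      have := mul_lt_mul_of_pos_right hd1 hα0
      rw [sub_mul, one_div_mul_cancel hα0.ne'] at this
      linarith
    refine (integrable_one_add_norm (E := ℝ) (r := (1 - d) * α) (by simpa using h1)).congr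
      (ae_of_all _ fun x => ?_)
    have hx : 0 ≤ 1 + ‖x‖ := by positivity
    simp only
    rw [Real.norm_of_nonneg (Real.rpow_nonneg hx _), ← Real.rpow_mul hx]
    congr 1
    ring
  refine (hJ.const_mul K).mono (measurable_fracIntegralLeft hg).aestronglyMeasurable
    (ae_of_all _ fun x => ?_)
  rw [Real.norm_eq_abs, Real.norm_eq_abs]
  exact (hK x).trans (le_abs_self _)

end

end FIMA

end

theorem theorem4p1 {Ω : Type*} [MeasurableSpace Ω] (P : Measure Ω) [IsProbabilityMeasure P]
    (α d : ℝ) (hα1 : 1 < α) (hα2 : α < 2) (hd0 : 0 < d) (hd1 : d < 1 - 1 / α)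
    (L : ℝ → Ω → ℝ) (hL : FIMA.IsStableMotion α L P)
    (g : ℝ → ℝ) (hg : Measurable g)
    (hC1 : ∀ t : ℝ, t < 0 → g t = 0)
    (hC2 : ∃ C c : ℝ, 0 < C ∧ 0 < c ∧ ∀ t : ℝ, |g t| ≤ C * Real.exp (-c * t)) :
    -- the fractional integral converges everywhere and lies in `L^α`
    (∀ x : ℝ, IntegrableOn (fun t => g t * (x - t) ^ (d - 1)) (Set.Iic x) volume) ∧
    MemLp (FIMA.fracIntegralLeft d g) (ENNReal.ofReal α) volume ∧
    -- the process exists and is unique up to modification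
    (∃ Y : ℝ → Ω → ℝ, FIMA.IsFIMAProcess α d g L P Y ∧
      ∀ Y' : ℝ → Ω → ℝ, FIMA.IsFIMAProcess α d g L P Y' → ∀ t : ℝ, Y' t =ᵐ[P] Y t) ∧
    -- the process is stationary
    (∀ Y : ℝ → Ω → ℝ, FIMA.IsFIMAProcess α d g L P Y → FIMA.IsStationary Y P) := by
  obtain ⟨C, c, -, hc, hgC⟩ := hC2
  have hF := FIMA.memLp_fracIntegralLeft hα1 hd0 hd1 hg hC1 hc hgC
  have hex : ∀ t : ℝ, ∃ Z : Ω → ℝ, FIMA.IsStableIntegral α L P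
      ((Set.Iic t).indicator (fun x => FIMA.fracIntegralLeft d g (t - x))) Z := by
    intro t
    have hf : MemLp ((Set.Iic t).indicator (fun x => FIMA.fracIntegralLeft d g (t - x)))
        (ENNReal.ofReal α) volume :=
      (hF.comp_measurePreserving (volume.measurePreserving_sub_left t)).indicator measurableSet_Iic
    exact hL.exists_isStableIntegral hα1 hf
  choose Y hY using hex
  exact ⟨FIMA.integrableOn_mul_sub_rpow hd0 hg hC1 hc hgC, hF,
    ⟨Y, hY, fun Y' hY' t => (hY' t).ae_eq hα1 (hY t)⟩, fun Y' hY' => hY'.isStationary hα1 hL⟩
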